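/- Call a topological space $Z$ *$d$-separable* (respectively *$nwd$-separable*) if there are discrete (respectively nowhere dense) sets $D_n\subseteq Z$ $(n<\omega)$ such that $\bigcup_{n<\omega}D_n$ is dense in $Z$, and *$NWD$-separable* if for every sequence $(D_n)_{n<\omega}$ of dense subsets of $Z$ there are nowhere dense sets $E_n\subseteq D_n$ such that $\bigcup_{n<\omega}E_n$ is dense in $Z$. A *$\pi$-base* of $Z$ is a family $\mathcal U$ of nonempty open sets such that every nonempty open set contains a member of $\mathcal U$; it is *$\kappa$-deep* (for a cardinal $\kappa$) if $\operatorname{int}\bigl(\bigcap_{\alpha<\kappa}U_\alpha\bigr)\neq\emptyset$ for every decreasing sequence $(U_\alpha)_{\alpha<\kappa}$ of members of $\mathcal U$. There is a regular Hausdorff space $X$ without isolated points, of size $2^{2^{\mathfrak c}}$, with a $\pi$-base that is $\kappa$-deep for every cardinal $\kappa\le 2^{\mathfrak c}$ (in particular $2^{\mathfrak c}$-deep), such that the product $X\times 2^{\mathfrak c}$, where $2^{\mathfrak c}=\{0,1\}^{\mathfrak c}$ carries the product topology, has size $2^{2^{\mathfrak c}}$, is $nwd$-separable, is not $d$-separable,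 and is not $NWD$-separable. -/

import Mathlib

open Cardinal

/-- A space is `d`-separable if it has a dense subset which is a countable union of discrete
subsets (a subset is discrete if its subspace topology is discrete). -/
def DSeparable (X : Type*) [TopologicalSpace X] : Prop :=
  ∃ D : ℕ → Set X, (∀ n, IsDiscrete (D n)) ∧ Dense (⋃ n, D n)

/-- A space is `nwd`-separable if it has a dense subset which is a countable union of nowhere
dense subsets. -/
def NwdSeparable (X : Type*) [TopologicalSpace X] : Prop :=
  ∃ D : ℕ → Set X, (∀ n, IsNowhereDense (D n)) ∧ Dense (⋃ n, D n)

/-- A space is `NWD`-separable (the selective version) if from every sequence of dense sets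
one can choose nowhere dense subsets whose union is dense. -/
def SelNwdSeparable (X : Type*) [TopologicalSpace X] : Prop :=
  ∀ D : ℕ → Set X, (∀ n, Dense (D n)) →
    ∃ E : ℕ → Set X, (∀ n, E n ⊆ D n ∧ IsNowhereDense (E n)) ∧ Dense (⋃ n, E n)

/-- A `π`-base: a family of nonempty open sets such that every nonempty open set contains a
member of the family. -/
structure IsPiBase {X : Type*} [TopologicalSpace X] (𝒰 : Set (Set X)) : Prop where
  isOpen : ∀ U ∈ 𝒰, IsOpen U
  nonempty : ∀ U ∈ 𝒰, U.Nonempty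
  exists_subset : ∀ W : Set X, IsOpen W → W.Nonempty → ∃ U ∈ 𝒰, U ⊆ W

/-- A family of sets is `κ`-deep if for each decreasing sequence of its members, indexed by the
ordinals below (the initial ordinal of) `κ`, the intersection has nonempty interior. -/
def IsDeep {X : Type*} [TopologicalSpace X] (κ : Cardinal) (𝒰 : Set (Set X)) : Prop :=
  ∀ U : κ.ord.ToType → Set X, (∀ i, U i ∈ 𝒰) → Antitone U → (interior (⋂ i, U i)).Nonempty

/-! Put l = 2^𝔠 and let X consist of the subsets of size at most l of a set K with #K = 2^l, a
neighbourhood being decided by at most l coordinates. Decreasing intersections of at most l nonempty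
boxes are nonempty boxes, so a transfinite recursion finds one open V deciding l many properties at
once (`exists_isOpen_forall`). The cube Z has only l points, so V can treat all fibres of countably
many subsets of X × Z simultaneously.

If the D n are discrete, so are their fibres, and since X has no isolated points V can avoid them
all; then V × Z misses every D n. For the selective property, Z has a dense Y in which no countable
union of nowhere dense sets is dense in Z (`exists_dense_cube_not_nwdSeparable`). Given nowhere
dense E n ⊆ X × Y, let V make each fibre either dense in V or disjoint from V; the projections of
the E n over V are then nowhere dense subsets of Y, so their union is not dense. Finally, Z is
separable without isolated points, and the slices X × {d n} give `nwd`-separability. -/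

/-! ### The Cantor cube is not selectively `nwd`-separable -/

/-- The cylinder of a cube determined by finitely many prescribed values. -/
def cylinder {ι : Type} (p : Finset (ι × Bool)) : Set (ι → Bool) :=
  {y | ∀ a ∈ p, y a.1 = a.2}

theorem isOpen_cylinder {ι : Type} (p : Finset (ι × Bool)) : IsOpen (cylinder p) := by
  have h : cylinder p = ⋂ a ∈ p, (fun y : ι → Bool => y a.1) ⁻¹' {a.2} := by
    ext y; simp [cylinder]
  rw [h]
  exact isOpen_biInter_finset fun a _ => (isOpen_discrete _).preimage (continuous_apply _)

theorem exists_agree_subset {ι : Type} {U : Set (ι → Bool)} (hU : IsOpen U) {y : ι → Bool}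
    (hy : y ∈ U) : ∃ S : Finset ι, ∀ z : ι → Bool, (∀ x ∈ S, z x = y x) → z ∈ U := by
  obtain ⟨S, u, hu, hsub⟩ := isOpen_pi_iff.1 hU y hy
  exact ⟨S, fun z hz => hsub fun x hx => by rw [hz x hx]; exact (hu x hx).2⟩

theorem exists_cylinder_subset {ι : Type} {U : Set (ι → Bool)} (hU : IsOpen U) {y : ι → Bool}
    (hy : y ∈ U) : ∃ p : Finset (ι × Bool), y ∈ cylinder p ∧ cylinder p ⊆ U := by
  classical
  obtain ⟨S, hS⟩ := exists_agree_subset hU hy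
  refine ⟨S.image fun x => (x, y x), ?_, fun z hz => hS z fun x hx => ?_⟩
  · intro a ha
    obtain ⟨x, -, rfl⟩ := Finset.mem_image.1 ha
    rfl
  · exact hz (x, y x) (Finset.mem_image_of_mem _ hx)

/-- Finite unions of rational intervals form a countable dense subset of `{0,1}^ℝ`. -/
theorem separableSpace_cube : TopologicalSpace.SeparableSpace (ℝ → Bool) := by
  classical
  let f : Finset (ℚ × ℚ) → ℝ → Bool := fun F x => decide (∃ p ∈ F, (p.1 : ℝ) < x ∧ x < p.2)
  refine ⟨Set.range f, Set.countable_range f, dense_iff_inter_open.2 ?_⟩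
  rintro U hU ⟨y, hy⟩
  obtain ⟨S, hS⟩ := exists_agree_subset hU hy
  have h : ∀ x : ℝ, ∃ p : ℚ × ℚ, ((p.1 : ℝ) < x ∧ x < p.2) ∧
      ∀ z ∈ S, (p.1 : ℝ) < z → z < p.2 → z = x := by
    intro x
    have hopen : IsOpen ((↑(S.erase x) : Set ℝ)ᶜ) := (S.erase x).finite_toSet.isClosed.isOpen_compl
    obtain ⟨v, hv, hxv, hsub⟩ :=
      Real.isTopologicalBasis_Ioo_rat.exists_subset_of_mem_open (a := x) (by simp) hopen
    simp only [Set.mem_iUnion, Set.mem_singleton_iff] at hv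
    obtain ⟨a, b, -, rfl⟩ := hv
    refine ⟨(a, b), hxv, fun z hz h1 h2 => ?_⟩
    by_contra hne
    exact hsub ⟨h1, h2⟩ (by simp [hz, hne])
  choose p hp hp' using h
  refine ⟨f ((S.filter fun x => y x = true).image p), hS _ fun x hx => ?_, Set.mem_range_self _⟩
  rw [Bool.eq_iff_iff, decide_eq_true_iff]
  constructor
  · rintro ⟨q, hq, h1, h2⟩
    obtain ⟨w, hw, rfl⟩ := Finset.mem_image.1 hq
    rw [hp' w x hx h1 h2]
    exact (Finset.mem_filter.1 hw).2
  · intro h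
    exact ⟨p x, Finset.mem_image_of_mem _ (Finset.mem_filter.2 ⟨hx, h⟩), hp x⟩

/-- Separability lets countably many cylinders suffice, so a nowhere dense set is avoided by a dense
open set with a countable code; there are only 𝔠 such codes when `ι` is `ℝ`. -/
theorem exists_seq_cylinder_dense {ι : Type} [TopologicalSpace.SeparableSpace (ι → Bool)]
    {E : Set (ι → Bool)} (hE : IsNowhereDense E) :
    ∃ p : ℕ → Finset (ι × Bool), Dense (⋃ m, cylinder (p m)) ∧
      Disjoint E (⋃ m, cylinder (p m)) := by
  have hd : Dense (closure E)ᶜ := interior_eq_empty_iff_dense_compl.1 hE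
  have ho : IsOpen (closure E)ᶜ := isClosed_closure.isOpen_compl
  let d := TopologicalSpace.denseSeq (ι → Bool)
  have h : ∀ m, ∃ p : Finset (ι × Bool), cylinder p ⊆ (closure E)ᶜ ∧
      (d m ∈ (closure E)ᶜ → d m ∈ cylinder p) := by
    intro m
    by_cases hm : d m ∈ (closure E)ᶜ
    · obtain ⟨p, h1, h2⟩ := exists_cylinder_subset ho hm
      exact ⟨p, h2, fun _ => h1⟩
    · obtain ⟨y, hy⟩ := hd.nonempty
      obtain ⟨p, -, h2⟩ := exists_cylinder_subset ho hy
      exact ⟨p, h2, fun h => absurd h hm⟩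
  choose p hp hp' using h
  refine ⟨p, ?_, ?_⟩
  · refine (hd.inter_of_isOpen_left (TopologicalSpace.denseRange_denseSeq _) ho).mono ?_
    rintro _ ⟨hy, m, rfl⟩
    exact Set.mem_iUnion.2 ⟨m, hp' m hy⟩
  · rw [Set.disjoint_left]
    intro y hy hy'
    obtain ⟨m, hm⟩ := Set.mem_iUnion.1 hy'
    exact hp m hm (subset_closure hy)

/-- Given an assignment `e` of coordinates to codes of sequences of open sets, the points that
take the value `true` at the coordinate of a sequence of dense open sets only if they lie in all
of them. -/
def codedSet {ι : Type} (e : (ℕ → ℕ → Finset (ι × Bool)) → ι) : Set (ι → Bool) :=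
  {y | ∀ c, (∀ n, Dense (⋃ m, cylinder (c n m))) → y (e c) = true →
    ∀ n, y ∈ ⋃ m, cylinder (c n m)}

theorem exists_countable_closed_coords {ι : Type} {e : (ℕ → ℕ → Finset (ι × Bool)) → ι}
    (he : Function.Injective e) (S : Finset ι) :
    ∃ J : Set ι, J.Countable ∧ ↑S ⊆ J ∧ ∀ c, e c ∈ J → ∀ n m, ∀ a ∈ c n m, a.1 ∈ J := by
  let G : Set ι → Set ι := fun J => ⋃ c ∈ e ⁻¹' J, ⋃ n, ⋃ m, Prod.fst '' (↑(c n m) : Set (ι × Bool))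
  have hG : ∀ J : Set ι, J.Countable → (G J).Countable := fun J hJ =>
    (hJ.preimage_of_injOn he.injOn).biUnion fun c _ =>
      Set.countable_iUnion fun n => Set.countable_iUnion fun m =>
        ((c n m).countable_toSet).image _
  have hk : ∀ k : ℕ, (G^[k] ↑S).Countable := by
    intro k
    induction k with
    | zero => exact S.countable_toSet
    | succ k ih => rw [Function.iterate_succ_apply']; exact hG _ ih
  refine ⟨⋃ k : ℕ, G^[k] ↑S, Set.countable_iUnion hk, Set.subset_iUnion (fun k : ℕ => G^[k] ↑S) 0, ?_⟩
  intro c hc n m a ha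
  obtain ⟨k, hk⟩ := Set.mem_iUnion.1 hc
  refine Set.mem_iUnion.2 ⟨k + 1, ?_⟩
  rw [Function.iterate_succ_apply']
  exact Set.mem_biUnion (show c ∈ e ⁻¹' _ from hk) <|
    Set.mem_iUnion.2 ⟨n, Set.mem_iUnion.2 ⟨m, a, ha, rfl⟩⟩

/-- Countably many coordinates closed under the coding involve only countably many codes, which the
Baire property of the cube handles together. -/
theorem dense_codedSet {ι : Type} {e : (ℕ → ℕ → Finset (ι × Bool)) → ι}
    (he : Function.Injective e) : Dense (codedSet e) := by
  classical
  refine dense_iff_inter_open.2 ?_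
  rintro U hU ⟨y, hy⟩
  obtain ⟨S, hS⟩ := exists_agree_subset hU hy
  obtain ⟨J, hJ, hSJ, hcl⟩ := exists_countable_closed_coords he S
  let A := {c | e c ∈ J ∧ ∀ n, Dense (⋃ m, cylinder (c n m))}
  have hA : A.Countable :=
    (hJ.preimage_of_injOn he.injOn).mono fun c hc => hc.1
  have := hA.to_subtype
  have hd : Dense (⋂ q : A × ℕ, ⋃ m, cylinder (q.1.1 q.2 m)) :=
    dense_iInter_of_isOpen (fun q => isOpen_iUnion fun m => isOpen_cylinder _)
      fun q => q.1.2.2 q.2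
  obtain ⟨y₀, h1, h2⟩ := hd.inter_open_nonempty _
    (isOpen_cylinder (S.image fun x => (x, y x))) ⟨y, fun a ha => by
      obtain ⟨x, -, rfl⟩ := Finset.mem_image.1 ha
      rfl⟩
  -- The value `false` off `J` makes every code with coordinate outside `J` vacuous; the remaining
  -- cylinders depend only on `J`.
  refine ⟨fun x => if x ∈ J then y₀ x else false, hS _ fun x hx => ?_, ?_⟩
  · rw [if_pos (hSJ hx)]
    exact h1 (x, y x) (Finset.mem_image_of_mem _ hx)
  · intro c hc hcy n
    have hcJ : e c ∈ J := by
      by_contra h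
      simp [h] at hcy
    obtain ⟨m, hm⟩ := Set.mem_iUnion.1 (Set.mem_iInter.1 h2 (⟨c, hcJ, hc⟩, n))
    refine Set.mem_iUnion.2 ⟨m, fun a ha => ?_⟩
    show (if a.1 ∈ J then y₀ a.1 else false) = a.2
    rw [if_pos (hcl c hcJ n m a ha)]
    exact hm a ha

/-- Diagonalisation: if `c` codes dense open sets avoiding the respective `E n`, the open set where
coordinate `e c` is `true` misses every `E n`. -/
theorem not_dense_iUnion_of_subset_codedSet {ι : Type} [TopologicalSpace.SeparableSpace (ι → Bool)]
    (e : (ℕ → ℕ → Finset (ι × Bool)) → ι) {E : ℕ → Set (ι → Bool)}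
    (hsub : ∀ n, E n ⊆ codedSet e) (hE : ∀ n, IsNowhereDense (E n)) : ¬ Dense (⋃ n, E n) := by
  intro hd
  choose c hc hc' using fun n => exists_seq_cylinder_dense (hE n)
  obtain ⟨y, hy, hy'⟩ := hd.inter_open_nonempty _ (isOpen_cylinder {(e c, true)})
    ⟨fun _ => true, by simp [cylinder]⟩
  obtain ⟨n, hn⟩ := Set.mem_iUnion.1 hy'
  exact Set.disjoint_left.1 (hc' n) hn (hsub n hn c hc (hy (e c, true) (by simp)) n)

theorem exists_injective_code :
    ∃ e : (ℕ → ℕ → Finset (ℝ × Bool)) → ℝ, Function.Injective e := by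
  have h : #(ℕ → ℕ → Finset (ℝ × Bool)) ≤ #ℝ := by
    have h1 : #(Finset (ℝ × Bool)) = 𝔠 := by
      rw [mk_finset_of_infinite]
      simp [mk_real]
    simp only [← power_def, h1, mk_real, mk_nat, continuum_power_aleph0, le_refl]
  obtain ⟨e⟩ := (le_def _ _).1 h
  exact ⟨e, e.injective⟩

/-- The Cantor cube of weight `𝔠` has a dense subset in which no countable union of nowhere dense
sets is dense. -/
theorem exists_dense_cube_not_nwdSeparable :
    ∃ Y : Set (ℝ → Bool), Dense Y ∧ ∀ E : ℕ → Set (ℝ → Bool), (∀ n, E n ⊆ Y) →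
      (∀ n, IsNowhereDense (E n)) → ¬ Dense (⋃ n, E n) := by
  have := separableSpace_cube
  obtain ⟨e, he⟩ := exists_injective_code
  exact ⟨codedSet e, dense_codedSet he, fun E h1 h2 => not_dense_iUnion_of_subset_codedSet e h1 h2⟩

/-! ### The space of small subsets -/

/-- The subsets of `K` of cardinality at most `l`. -/
def SmallSet (K : Type) (l : Cardinal.{0}) : Type := {f : Set K // #f ≤ l}

/-- The small sets that contain `s.1` and are disjoint from `s.2`. -/
def box {K : Type} {l : Cardinal.{0}} (s : Set K × Set K) : Set (SmallSet K l) :=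
  {f | s.1 ⊆ f.1 ∧ Disjoint f.1 s.2}

/-- The topology in which a set is a neighbourhood of `f` as soon as it contains all small sets
that agree with `f` on some set of at most `l` coordinates. -/
instance {K : Type} {l : Cardinal.{0}} [hl : Fact (ℵ₀ ≤ l)] : TopologicalSpace (SmallSet K l) where
  IsOpen U := ∀ f ∈ U, ∃ S : Set K, #S ≤ l ∧ ∀ g : SmallSet K l, (∀ x ∈ S, x ∈ g.1 ↔ x ∈ f.1) → g ∈ U
  isOpen_univ := fun _ _ => ⟨∅, by simp, fun _ _ => trivial⟩
  isOpen_inter := by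
    rintro U V hU hV f ⟨hfU, hfV⟩
    obtain ⟨S, hS, hS'⟩ := hU f hfU
    obtain ⟨T, hT, hT'⟩ := hV f hfV
    exact ⟨S ∪ T, (mk_union_le S T).trans (add_le_of_le hl.1 hS hT), fun g hg =>
      ⟨hS' g fun x hx => hg x (.inl hx), hT' g fun x hx => hg x (.inr hx)⟩⟩
  isOpen_sUnion := by
    rintro 𝒮 h𝒮 f ⟨U, hU, hfU⟩
    obtain ⟨S, hS, hS'⟩ := h𝒮 U hU f hfU
    exact ⟨S, hS, fun g hg => ⟨U, hU, hS' g hg⟩⟩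

section SmallSet

variable {K : Type} {l : Cardinal.{0}}

theorem mk_iUnion_le_of_le (hl : ℵ₀ ≤ l) {ι : Type} (hι : #ι ≤ l) {s : ι → Set K}
    (hs : ∀ i, #(s i) ≤ l) : #(⋃ i, s i) ≤ l :=
  (mk_iUnion_le s).trans <| (mul_le_mul' hι (ciSup_le' hs)).trans (mul_eq_self hl).le

theorem box_iUnion {ι : Type} (s : ι → Set K × Set K) :
    (box (⋃ i, (s i).1, ⋃ i, (s i).2) : Set (SmallSet K l)) = ⋂ i, box (s i) := by
  ext f
  simp [box, forall_and]

variable [hl : Fact (ℵ₀ ≤ l)]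

theorem SmallSet.isOpen_iff {U : Set (SmallSet K l)} : IsOpen U ↔ ∀ f ∈ U, ∃ S : Set K, #S ≤ l ∧
    ∀ g : SmallSet K l, (∀ x ∈ S, x ∈ g.1 ↔ x ∈ f.1) → g ∈ U := Iff.rfl

theorem isOpen_box {s : Set K × Set K} (h1 : #s.1 ≤ l) (h2 : #s.2 ≤ l) :
    IsOpen (box s : Set (SmallSet K l)) := by
  rw [SmallSet.isOpen_iff]
  rintro f ⟨hf1, hf2⟩
  refine ⟨s.1 ∪ s.2, (mk_union_le _ _).trans (add_le_of_le hl.1 h1 h2), fun g hg => ⟨?_, ?_⟩⟩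
  · exact fun x hx => (hg x (.inl hx)).2 (hf1 hx)
  · rw [Set.disjoint_left] at hf2 ⊢
    exact fun x hx hx2 => hf2 ((hg x (.inr hx2)).1 hx) hx2

theorem isClosed_box (s : Set K × Set K) : IsClosed (box s : Set (SmallSet K l)) := by
  rw [← isOpen_compl_iff, SmallSet.isOpen_iff]
  intro f hf
  have h : ∃ x, (x ∈ s.1 ∧ x ∉ f.1) ∨ (x ∈ f.1 ∧ x ∈ s.2) := by
    by_contra! h
    exact hf ⟨fun x hx => by_contra fun hxf => hxf ((h x).1 hx),
      Set.disjoint_left.2 fun x hx hx2 => (h x).2 hx hx2⟩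
  obtain ⟨x, hx⟩ := h
  refine ⟨{x}, by simpa using one_le_aleph0.trans hl.1, fun g hg hgs => ?_⟩
  have hgx := hg x rfl
  rcases hx with ⟨hx, hxf⟩ | ⟨hxf, hx⟩
  · exact hxf (hgx.1 (hgs.1 hx))
  · exact Set.disjoint_left.1 hgs.2 (hgx.2 hxf) hx

theorem exists_box_subset {U : Set (SmallSet K l)} (hU : IsOpen U) {f : SmallSet K l}
    (hf : f ∈ U) : ∃ s : Set K × Set K, #s.1 ≤ l ∧ #s.2 ≤ l ∧ f ∈ (box s : Set (SmallSet K l)) ∧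
      box s ⊆ U := by
  obtain ⟨S, hS, hS'⟩ := SmallSet.isOpen_iff.1 hU f hf
  refine ⟨(S ∩ f.1, S \ f.1), (mk_le_mk_of_subset Set.inter_subset_left).trans hS,
    (mk_le_mk_of_subset Set.sdiff_subset).trans hS, ⟨Set.inter_subset_right, ?_⟩, ?_⟩
  · exact Set.disjoint_sdiff_right
  · rintro g ⟨hg1, hg2⟩
    refine hS' g fun x hx => ⟨fun hxg => ?_, fun hxf => hg1 ⟨hx, hxf⟩⟩
    by_contra hxf
    exact Set.disjoint_left.1 hg2 hxg ⟨hx, hxf⟩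

instance : T3Space (SmallSet K l) := by
  have hr : RegularSpace (SmallSet K l) := by
    refine RegularSpace.of_exists_mem_nhds_isClosed_subset fun f U hU => ?_
    obtain ⟨V, hVU, hV, hfV⟩ := mem_nhds_iff.1 hU
    obtain ⟨s, h1, h2, hfs, hsV⟩ := exists_box_subset hV hfV
    exact ⟨box s, (isOpen_box h1 h2).mem_nhds hfs, isClosed_box s, hsV.trans hVU⟩
  have ht : T0Space (SmallSet K l) := by
    refine ⟨fun f g hfg => Subtype.ext (Set.ext fun x => ?_)⟩
    have h : IsOpen (box ({x}, ∅) : Set (SmallSet K l)) :=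
      isOpen_box (by simpa using one_le_aleph0.trans hl.1) (by simp)
    simpa [box] using hfg.mem_open_iff h
  exact {}

theorem perfectSpace_smallSet (hK : l < #K) : PerfectSpace (SmallSet K l) := by
  rw [perfectSpace_iff_forall_not_isolated]
  intro f
  rw [← mem_closure_iff_nhdsWithin_neBot, mem_closure_iff]
  intro U hU hfU
  obtain ⟨S, hS, hS'⟩ := SmallSet.isOpen_iff.1 hU f hfU
  have hlt : #(S ∪ f.1 : Set K) < #K :=
    ((mk_union_le _ _).trans (add_le_of_le hl.1 hS f.2)).trans_lt hK
  obtain ⟨x, hx⟩ : ∃ x, x ∉ S ∪ f.1 := by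
    by_contra! h
    rw [Set.eq_univ_of_forall h, mk_univ] at hlt
    exact hlt.false
  have hx' := not_or.1 hx
  refine ⟨⟨insert x f.1, mk_insert_le.trans (add_le_of_le hl.1 f.2 (one_le_aleph0.trans hl.1))⟩,
    hS' _ fun y hy => ?_, fun h => ?_⟩
  · have hne : y ≠ x := fun h => hx'.1 (h ▸ hy)
    simp [hne]
  · exact hx'.2 (congrArg Subtype.val h ▸ Set.mem_insert x f.1)

theorem mk_smallSet (hK : ℵ₀ ≤ #K) (hpow : #K ^ l = #K) : #(SmallSet K l) = #K := by
  apply le_antisymm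
  · refine (mk_bounded_set_le K l).trans ?_
    rw [max_eq_left hK, hpow]
  · refine mk_le_of_injective (f := fun x => (⟨{x}, by simpa using one_le_aleph0.trans hl.1⟩ : SmallSet K l)) ?_
    intro x y h
    exact Set.singleton_injective (congrArg Subtype.val h)

/-- An intersection of at most `l` boxes that meet pairwise is nonempty. -/
theorem nonempty_box_iUnion {ι : Type} (hι : #ι ≤ l) {s : ι → Set K × Set K}
    (h1 : ∀ i, #(s i).1 ≤ l)
    (hdir : ∀ i j, (box (s i) ∩ box (s j) : Set (SmallSet K l)).Nonempty) :
    (box (⋃ i, (s i).1, ⋃ i, (s i).2) : Set (SmallSet K l)).Nonempty := by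
  -- The union of the positive parts is itself small; pairwise compatibility keeps it off all
  -- negative parts.
  refine ⟨⟨⋃ i, (s i).1, mk_iUnion_le_of_le hl.1 hι h1⟩, subset_rfl, ?_⟩
  rw [Set.disjoint_iUnion_left]
  intro i
  rw [Set.disjoint_iUnion_right]
  intro j
  obtain ⟨f, hfi, hfj⟩ := hdir i j
  exact hfj.2.mono_left hfi.1

variable (K l) in
/-- The nonempty boxes given by small sets form a `π`-base. -/
def boxes : Set (Set (SmallSet K l)) :=
  {U | ∃ s : Set K × Set K, #s.1 ≤ l ∧ #s.2 ≤ l ∧ U.Nonempty ∧ box s = U}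

theorem isPiBase_boxes : IsPiBase (boxes K l) where
  isOpen := by
    rintro _ ⟨s, h1, h2, -, rfl⟩
    exact isOpen_box h1 h2
  nonempty := by
    rintro _ ⟨s, -, -, h, -⟩
    exact h
  exists_subset := by
    rintro W hW ⟨f, hf⟩
    obtain ⟨s, h1, h2, hfs, hsW⟩ := exists_box_subset hW hf
    exact ⟨box s, ⟨s, h1, h2, ⟨f, hfs⟩, rfl⟩, hsW⟩

theorem iInter_mem_boxes {ι : Type} [LinearOrder ι] (hι : #ι ≤ l) {U : ι → Set (SmallSet K l)}
    (hU : ∀ i, U i ∈ boxes K l) (hanti : Antitone U) : ⋂ i, U i ∈ boxes K l := by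
  choose s h1 h2 h3 h4 using hU
  refine ⟨(⋃ i, (s i).1, ⋃ i, (s i).2), mk_iUnion_le_of_le hl.1 hι h1,
    mk_iUnion_le_of_le hl.1 hι h2, ?_, ?_⟩
  · have h := nonempty_box_iUnion (l := l) hι h1 fun i j => by
      rw [h4, h4]
      exact (h3 (max i j)).mono
        (Set.subset_inter (hanti (le_max_left i j)) (hanti (le_max_right i j)))
    rw [box_iUnion] at h
    simpa only [h4] using h
  · rw [box_iUnion]
    simp only [h4]

theorem isDeep_boxes {κ : Cardinal.{0}} (hκ : κ ≤ l) : IsDeep κ (boxes K l) := by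
  intro U hU hanti
  have h := iInter_mem_boxes (by rwa [mk_ord_toType]) hU hanti
  rw [(isPiBase_boxes.isOpen _ h).interior_eq]
  exact isPiBase_boxes.nonempty _ h

end SmallSet

/-! ### Deciding many properties at once -/

section Generic

variable {K : Type} {l : Cardinal.{0}} [hl : Fact (ℵ₀ ≤ l)]

theorem inter_iInter_mem_boxes {ι : Type} [LinearOrder ι] (hι : #ι ≤ l) {W : Set (SmallSet K l)}
    (hW : W ∈ boxes K l) {U : ι → Set (SmallSet K l)} (hU : ∀ i, U i ∈ boxes K l)
    (hanti : Antitone U) (hUW : ∀ i, U i ⊆ W) : W ∩ ⋂ i, U i ∈ boxes K l := by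
  rcases isEmpty_or_nonempty ι with h | ⟨⟨i⟩⟩
  · simpa using hW
  · rw [Set.inter_eq_right.2 ((Set.iInter_subset U i).trans (hUW i))]
    exact iInter_mem_boxes hι hU hanti

/-- At most `l` properties of open sets, each inherited by subsets and satisfied by some nonempty
open subset of every nonempty open set, are simultaneously satisfied by some nonempty open set. -/
theorem exists_isOpen_forall {ι : Type} (hι : #ι ≤ l) {P : ι → Set (SmallSet K l) → Prop}
    (hmono : ∀ i V W, V ⊆ W → P i W → P i V)
    (hex : ∀ i W, IsOpen W → W.Nonempty → ∃ V, IsOpen V ∧ V.Nonempty ∧ V ⊆ W ∧ P i V) :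
    ∃ V : Set (SmallSet K l), IsOpen V ∧ V.Nonempty ∧ ∀ i, P i V := by
  classical
  obtain ⟨_, _⟩ := exists_wellFoundedLT ι
  have hex' : ∀ i W, ∃ V, V ⊆ W ∧ (W ∈ boxes K l → V ∈ boxes K l ∧ P i V) := by
    intro i W
    by_cases hW : W ∈ boxes K l
    · obtain ⟨V, hV, hVne, hVW, hPV⟩ :=
        hex i W (isPiBase_boxes.isOpen W hW) (isPiBase_boxes.nonempty W hW)
      obtain ⟨B, hB, hBV⟩ := isPiBase_boxes.exists_subset V hV hVne
      exact ⟨B, hBV.trans hVW, fun _ => ⟨hB, hmono i B V hBV hPV⟩⟩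
    · exact ⟨W, subset_rfl, fun h => absurd h hW⟩
  choose ext hext hext' using hex'
  obtain ⟨W₀, hW₀, -⟩ := isPiBase_boxes.exists_subset
    (Set.univ : Set (SmallSet K l)) isOpen_univ ⟨(Subtype.mk ∅ (by simp) : SmallSet K l), trivial⟩
  -- Intersecting with `W₀` provides a box at the least index, where there are no earlier stages.
  let U : ι → Set (SmallSet K l) :=
    wellFounded_lt.fix fun i rec => ext i (W₀ ∩ ⋂ j : Set.Iio i, rec j.1 j.2)
  have hU : ∀ i, U i = ext i (W₀ ∩ ⋂ j : Set.Iio i, U j.1) := fun i =>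
    wellFounded_lt.fix_eq _ i
  have hsub : ∀ i, U i ⊆ W₀ ∩ ⋂ j : Set.Iio i, U j.1 := fun i => (hU i).subset.trans (hext i _)
  have hanti : Antitone U := by
    intro i j hij
    rcases hij.eq_or_lt with rfl | hlt
    · exact subset_rfl
    · exact (hsub j).trans (Set.inter_subset_right.trans <|
        Set.iInter_subset (fun k : Set.Iio j => U k.1) ⟨i, hlt⟩)
  have hUW : ∀ i, U i ⊆ W₀ := fun i => (hsub i).trans Set.inter_subset_left
  have hmem : ∀ i, W₀ ∩ ⋂ j : Set.Iio i, U j.1 ∈ boxes K l := by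
    intro i
    induction i using WellFoundedLT.induction with
    | _ i ih =>
      refine inter_iInter_mem_boxes ((mk_set_le _).trans hι) hW₀ (fun j => ?_)
        (fun j k hjk => hanti hjk) fun j => hUW j
      rw [hU]
      exact (hext' _ _ (ih j.1 j.2)).1
  have hP : ∀ i, U i ∈ boxes K l ∧ P i (U i) := fun i => by
    rw [hU]
    exact hext' i _ (hmem i)
  have hfin := inter_iInter_mem_boxes hι hW₀ (fun i => (hP i).1) hanti hUW
  exact ⟨_, isPiBase_boxes.isOpen _ hfin, isPiBase_boxes.nonempty _ hfin, fun i =>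
    hmono i _ _ (Set.inter_subset_right.trans (Set.iInter_subset _ i)) (hP i).2⟩

end Generic

/-! ### Products with a small space -/

theorem nwdSeparable_prod {X Z : Type*} [TopologicalSpace X] [TopologicalSpace Z] [Nonempty Z]
    [T1Space Z] [PerfectSpace Z] [TopologicalSpace.SeparableSpace Z] : NwdSeparable (X × Z) := by
  let d := TopologicalSpace.denseSeq Z
  refine ⟨fun n => Set.univ ×ˢ {d n}, fun n => ?_, ?_⟩
  · rw [IsNowhereDense, closure_prod_eq, interior_prod_eq, closure_singleton, interior_singleton,
      Set.prod_empty]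
  · rw [← Set.prod_iUnion, Set.iUnion_singleton_eq_range]
    exact dense_univ.prod (TopologicalSpace.denseRange_denseSeq Z)

theorem mk_nat_prod_le {l : Cardinal.{0}} (hl : ℵ₀ ≤ l) {Z : Type} (hZ : #Z ≤ l) : #(ℕ × Z) ≤ l := by
  rw [mk_prod, lift_id, lift_id, mk_nat]
  exact (mul_le_mul' hl hZ).trans (mul_eq_self hl).le

section Product

variable {K : Type} {l : Cardinal.{0}} [hl : Fact (ℵ₀ ≤ l)] {Z : Type} [TopologicalSpace Z]

theorem not_dSeparable_prod (hK : l < #K) (hZ : #Z ≤ l) [Nonempty Z] :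
    ¬ DSeparable (SmallSet K l × Z) := by
  have := perfectSpace_smallSet hK
  rintro ⟨D, hD, hdense⟩
  obtain ⟨V, hV, hVne, hVD⟩ := exists_isOpen_forall (K := K) (mk_nat_prod_le hl.1 hZ)
    (P := fun i V => ∀ x ∈ V, (x, i.2) ∉ D i.1)
    (fun i V W hVW h x hx => h x (hVW hx)) (by
      rintro ⟨n, z⟩ W hW hWne
      by_cases h : ∃ x ∈ W, (x, z) ∈ D n
      · obtain ⟨x, hxW, hxD⟩ := h
        have := (hD n).to_subtype
        obtain ⟨O, hO, hOx⟩ := isOpen_induced_iff.1 (isOpen_discrete {(⟨(x, z), hxD⟩ : D n)})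
        have hO' : IsOpen {x' | (x', z) ∈ O} := hO.preimage (by fun_prop)
        have hxO : (x, z) ∈ O := by
          have : (⟨(x, z), hxD⟩ : D n) ∈ Subtype.val ⁻¹' O := hOx ▸ rfl
          exact this
        -- Within `O` the fibre is just `x`, and deleting this non-isolated point leaves a nonempty
        -- open set.
        refine ⟨(W ∩ {x' | (x', z) ∈ O}) \ {x}, (hW.inter hO').sdiff isClosed_singleton, ?_,
          fun x' hx' => hx'.1.1, ?_⟩
        · obtain ⟨x', hx', hne⟩ := mem_closure_iff.1
            (mem_closure_iff_nhdsWithin_neBot.2 (PerfectSpace.not_isolated x)) _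
            (hW.inter hO') ⟨hxW, hxO⟩
          exact ⟨x', hx', hne⟩
        · rintro x' ⟨⟨-, hx'O⟩, hne⟩ hx'D
          have : (⟨(x', z), hx'D⟩ : D n) ∈ Subtype.val ⁻¹' O := hx'O
          rw [hOx] at this
          exact hne (congrArg (fun q : D n => q.1.1) this)
      · push Not at h
        exact ⟨W, hW, hWne, subset_rfl, h⟩)
  obtain ⟨⟨x, z⟩, ⟨hx, -⟩, hxz⟩ := hdense.inter_open_nonempty _ (hV.prod isOpen_univ)
    (hVne.prod Set.univ_nonempty)
  obtain ⟨n, hn⟩ := Set.mem_iUnion.1 hxz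
  exact hVD (n, z) x hx hn

theorem not_selNwdSeparable_prod (hZ : #Z ≤ l) {Y : Set Z} (hY : Dense Y)
    (hYE : ∀ E : ℕ → Set Z, (∀ n, E n ⊆ Y) → (∀ n, IsNowhereDense (E n)) → ¬ Dense (⋃ n, E n)) :
    ¬ SelNwdSeparable (SmallSet K l × Z) := by
  intro h
  obtain ⟨E, hE, hdense⟩ := h (fun _ => Set.univ ×ˢ Y) fun _ => dense_univ.prod hY
  obtain ⟨V, hV, hVne, hVE⟩ := exists_isOpen_forall (K := K) (mk_nat_prod_le hl.1 hZ)
    (P := fun i V => V ⊆ closure {x | (x, i.2) ∈ E i.1} ∨ ∀ x ∈ V, (x, i.2) ∉ E i.1)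
    (fun i V W hVW h => h.imp hVW.trans fun h x hx => h x (hVW hx)) (by
      rintro ⟨n, z⟩ W hW hWne
      by_cases h : W ⊆ closure {x | (x, z) ∈ E n}
      · exact ⟨W, hW, hWne, subset_rfl, .inl h⟩
      · obtain ⟨x, hxW, hx⟩ := Set.not_subset.1 h
        exact ⟨W \ closure {x | (x, z) ∈ E n}, hW.sdiff isClosed_closure, ⟨x, hxW, hx⟩,
          Set.sdiff_subset, .inr fun x' hx' hE' => hx'.2 (subset_closure hE')⟩)
  let F : ℕ → Set Z := fun n => {z | ∃ x ∈ V, (x, z) ∈ E n}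
  refine hYE F ?_ ?_ ?_
  · rintro n z ⟨x, -, hx⟩
    exact ((hE n).1 hx).2
  · intro n
    -- A fibre of `E n` that meets `V` is dense in `V`, so an interior point of `closure (F n)`
    -- would give one of `closure (E n)`.
    have hsub : V ×ˢ closure (F n) ⊆ closure (E n) := by
      rw [← closure_closure (s := E n)]
      refine (Set.prod_mono subset_closure subset_rfl).trans ?_
      rw [← closure_prod_eq]
      refine closure_mono ?_
      rintro ⟨x, z⟩ ⟨hx, x', hx', hx'E⟩
      have hVn := (hVE (n, z)).resolve_right fun h => h x' hx' hx'E
      exact map_mem_closure (f := fun x => (x, z)) (by fun_prop) (hVn hx) fun y hy => hy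
    have hint := interior_mono hsub
    rw [interior_prod_eq, hV.interior_eq, (hE n).2, Set.subset_empty_iff,
      Set.prod_eq_empty_iff] at hint
    exact hint.resolve_left hVne.ne_empty
  · refine dense_iff_inter_open.2 fun O hO hOne => ?_
    obtain ⟨⟨x, z⟩, ⟨hx, hz⟩, hxz⟩ := hdense.inter_open_nonempty _ (hV.prod hO) (hVne.prod hOne)
    obtain ⟨n, hn⟩ := Set.mem_iUnion.1 hxz
    exact ⟨z, hz, Set.mem_iUnion.2 ⟨n, x, hx, hn⟩⟩

end Product

theorem perfectSpace_cube : PerfectSpace (ℝ → Bool) := by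
  classical
  rw [perfectSpace_iff_forall_not_isolated]
  intro y
  rw [← mem_closure_iff_nhdsWithin_neBot, mem_closure_iff]
  intro U hU hyU
  obtain ⟨S, hS⟩ := exists_agree_subset hU hyU
  obtain ⟨x, hx⟩ := Infinite.exists_notMem_finset S
  refine ⟨Function.update y x (!y x), hS _ fun z hz => ?_, fun h => ?_⟩
  · exact Function.update_of_ne (ne_of_mem_of_not_mem hz hx) _ _
  · simpa using congrFun h x

/-- `ℝ → Bool` with the product topology is the Cantor cube of weight `𝔠`, since `#ℝ = 𝔠`. -/
theorem mainTheorem12 :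
    ∃ (X : Type) (_ : TopologicalSpace X),
      T3Space X ∧ PerfectSpace X ∧ #X = (2 : Cardinal.{0}) ^ ((2 : Cardinal.{0}) ^ 𝔠) ∧
      (∃ 𝒰 : Set (Set X), IsPiBase 𝒰 ∧ ∀ κ : Cardinal.{0}, κ ≤ 2 ^ 𝔠 → IsDeep κ 𝒰) ∧
      #(X × (ℝ → Bool)) = (2 : Cardinal.{0}) ^ ((2 : Cardinal.{0}) ^ 𝔠) ∧
      NwdSeparable (X × (ℝ → Bool)) ∧
      ¬ DSeparable (X × (ℝ → Bool)) ∧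
      ¬ SelNwdSeparable (X × (ℝ → Bool)) := by
  have hinf : ℵ₀ ≤ (2 : Cardinal.{0}) ^ 𝔠 := aleph0_le_continuum.trans (cantor 𝔠).le
  have : Fact (ℵ₀ ≤ (2 : Cardinal.{0}) ^ 𝔠) := ⟨hinf⟩
  have hK : #(Set (Set ℝ)) = 2 ^ ((2 : Cardinal.{0}) ^ 𝔠) := by rw [mk_set, mk_set, mk_real]
  have hlt : (2 : Cardinal.{0}) ^ 𝔠 < #(Set (Set ℝ)) := hK ▸ cantor _
  have hX : #(SmallSet (Set (Set ℝ)) (2 ^ 𝔠)) = 2 ^ ((2 : Cardinal.{0}) ^ 𝔠) := by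
    rw [mk_smallSet (hinf.trans hlt.le), hK]
    -- (2^l)^l = 2^(l·l) = 2^l for l = 2^𝔠.
    rw [hK, ← power_mul, mul_eq_self hinf]
  have hZ : #(ℝ → Bool) = 2 ^ 𝔠 := by rw [← power_def, mk_bool, mk_real]
  have := separableSpace_cube
  have := perfectSpace_cube
  obtain ⟨Y, hY, hYE⟩ := exists_dense_cube_not_nwdSeparable
  refine ⟨SmallSet (Set (Set ℝ)) (2 ^ 𝔠), inferInstance, inferInstance, perfectSpace_smallSet hlt,
    hX, ⟨boxes _ _, isPiBase_boxes, fun κ hκ => isDeep_boxes hκ⟩, ?_, nwdSeparable_prod,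
    not_dSeparable_prod hlt hZ.le, not_selNwdSeparable_prod hZ.le hY hYE⟩
  rw [mk_prod, lift_id, lift_id, hX, hZ]
  exact mul_eq_left (hinf.trans (cantor _).le) (cantor _).le (power_ne_zero _ two_ne_zero)
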